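/- Let $n,m,d\in\{0,1,2,\dots\}$, $T>0$, $U\subset\mathbb R^d$, $g:\mathbb R^n\times\mathbb R^d\to\mathbb R^n$, $x_0\in\mathbb R^n$, $a_0\in\mathbb R^{mn}$, $b_0\in\mathbb R^m$. For $a=(a_1,\dots,a_m)\in\mathbb R^{mn}$ and $b\in\mathbb R^m$ put $C(a,b)=\{x\in\mathbb R^n:\langle a_i,x\rangle\le b_i,\ i=1,\dots,m\}$. Let $N(x;C)=\{v:\langle v,y-x\rangle\le 0\ \ \forall y\in C\}$ if $x\in C$ and $N(x;C)=\emptyset$ otherwise, and let $F(x,a,b,u)=N(x;C(a,b))-g(x,u)$. Let $\bar x\in W^{1,2}([0,T];\mathbb R^n)$, $\bar a\in W^{1,2}([0,T];\mathbb R^{mn})$, $\bar b\in W^{1,2}([0,T];\mathbb R^m)$, $\bar u\in L^2([0,T];\mathbb R^d)$ be a feasible solution of the controlled sweeping process, that is, $(\bar x,\bar a,\bar b)(0)=(x_0,a_0,b_0)$, and $$-\dot{\bar x}(t)\in F(\bar x(t),\bar a(t),\bar b(t),\bar u(t)),\quad \bar u(t)\in U\quad\text{for a.e. }t\in[0,T],$$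 $$\|\bar a_i(t)\|=1,\quad \langle\bar a_i(t),\bar x(t)\rangle\le\bar b_i(t)\quad\text{for all }t\in[0,T],\ i=1,\dots,m.$$ Assume the following. (H1) $U$ is closed and bounded. (H2) $\dot{\bar a}_i,\dot{\bar b}_i$ ($i=1,\dots,m$) are essentially bounded on $[0,T]$. (H3) There are $L,M>0$ with $\|g(x_1,u_1)-g(x_2,u_2)\|\le L(\|x_1-x_2\|+\|u_1-u_2\|)$ for all $(x_1,u_1),(x_2,u_2)\in\mathbb R^n\times U$ and $\|g(x,u)\|\le M(1+\|x\|)$ for all $(x,u)\in\mathbb R^n\times U$. (H4) There are $v_i\in W^{1,2}([0,T];\mathbb R)$ with $\|\bar a_i(t)-\bar a_i(s)\|\le|v_i(t)-v_i(s)|$ for all $s,t\in[0,T]$ and $i=1,\dots,m$, and there is a continuous $\vartheta:[0,T]\to\mathbb R$ with $\sup_{[0,T]}\vartheta<0$ such that for every $t\in[0,T]$ some $y\in\mathbb R^n$ satisfies $\langle\bar a_i(t),y\rangle-\bar b_i(t)<\vartheta(t)$ for $i=1,\dots,m$. Assume also that $\dot{\bar x},\dot{\bar a},\dot{\bar b},\bar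 u$ are of bounded variation on $[0,T]$ (that is, have representatives of bounded variation). Then there are a constant $\tilde\nu>0$, partitions $\Delta_k=\{0=t^k_0<t^k_1<\dots<t^k_{\nu(k)}=T\}$ with $\nu(k)\ge k$ and $t^k_{j+1}-t^k_j\le\tilde\nu/\nu(k)$ for $j=0,\dots,\nu(k)-1$, numbers $\delta_k>0$ with $\delta_k\to0$, continuous functions $x^k,a^k,b^k$ on $[0,T]$ that are affine on each $[t^k_j,t^k_{j+1}]$, and functions $u^k:[0,T]\to U$ that are constant on each $[t^k_j,t^k_{j+1})$, such that for all $k\in\mathbb N$ one has $(x^k(0),a^k(0),b^k(0))=(x_0,a_0,b_0)$, $$1-\delta_k\le\|a^k_i(t^k_j)\|\le1+\delta_k,\qquad j=0,\dots,\nu(k),\ i=1,\dots,m,$$ $$x^k(t)=x^k(t^k_j)+(t-t^k_j)v^k_j\ \text{ for } t\in[t^k_j,t^k_{j+1}],\quad\text{with } -v^k_j\in F\big(x^k(t^k_j),a^k(t^k_j),b^k(t^k_j),u^k(t^k_j)\big),\qquad j=0,\dots,\nu(k)-1,$$ and such that, as $k\to\infty$, $(x^k,a^k,b^k)\to(\bar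 x,\bar a,\bar b)$ in the norm topology of $W^{1,2}([0,T])$ and $u^k\to\bar u$ in the norm topology of $L^2([0,T];\mathbb R^d)$. -/

import Mathlib

open MeasureTheory Set Filter
open scoped Topology

noncomputable section

/-- The space `ℝⁿ` with its Euclidean norm. -/
abbrev RSpace (n : ℕ) : Type := EuclideanSpace ℝ (Fin n)

/-- The space `ℝ^{mn}` of families `(a₁, …, a_m)` of vectors of `ℝⁿ`, with its Euclidean norm. -/
abbrev RFamily (m n : ℕ) : Type := PiLp 2 (fun _ : Fin m => RSpace n)

/-- The restriction of Lebesgue measure to `[0,T]`. -/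
abbrev timeMeasure (T : ℝ) : Measure ℝ := volume.restrict (Icc 0 T)

section Sobolev

variable {E : Type*} [NormedAddCommGroup E] [NormedSpace ℝ E]

/-- `w` is (a representative of) the derivative of the `W^{1,2}` arc `f` on `[0,T]`:
`w` is square integrable on `[0,T]` and `f` is an indefinite integral of `w` there. -/
def IsArcDeriv (T : ℝ) (f w : ℝ → E) : Prop :=
  MemLp w 2 (timeMeasure T) ∧ ∀ t ∈ Icc 0 T, f t = f 0 + ∫ s in (0 : ℝ)..t, w s

/-- `f ∈ W^{1,2}([0,T]; E)`. -/
def MemW12 (T : ℝ) (f : ℝ → E) : Prop :=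
  ∃ w : ℝ → E, IsArcDeriv T f w

/-- `f ∈ W^{1,2}([0,T]; E)` and its derivative, which is determined up to null sets, is of
bounded variation on `[0,T]` (that is, has a representative of bounded variation). -/
def HasBVDeriv (T : ℝ) (f : ℝ → E) : Prop :=
  ∃ w : ℝ → E, IsArcDeriv T f w ∧ BoundedVariationOn w (Icc 0 T)

/-- Convergence in the norm topology of `L²([0,T]; E)`. -/
def TendstoL2 (T : ℝ) (F : ℕ → ℝ → E) (f : ℝ → E) : Prop :=
  (∀ k, MemLp (F k) 2 (timeMeasure T)) ∧ MemLp f 2 (timeMeasure T) ∧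
    Tendsto (fun k => eLpNorm (fun t => F k t - f t) 2 (timeMeasure T)) atTop (𝓝 0)

/-- Convergence in the norm topology of `W^{1,2}([0,T]; E)`: the functions and their derivatives
converge in `L²`. -/
def TendstoW12 (T : ℝ) (F : ℕ → ℝ → E) (f : ℝ → E) : Prop :=
  ∃ (W : ℕ → ℝ → E) (w : ℝ → E),
    (∀ k, IsArcDeriv T (F k) (W k)) ∧ IsArcDeriv T f w ∧ TendstoL2 T F f ∧ TendstoL2 T W w

/-- `0 = t₀ < t₁ < ⋯ < t_N = T`. Only the values `t j` with `j ≤ N` matter. -/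
structure IsPartition (T : ℝ) (N : ℕ) (t : ℕ → ℝ) : Prop where
  left : t 0 = 0
  right : t N = T
  lt : ∀ j < N, t j < t (j + 1)

/-- `f` is affine on each closed mesh interval `[t_j, t_{j+1}]`, `j < N`. -/
def IsPiecewiseLinear (N : ℕ) (t : ℕ → ℝ) (f : ℝ → E) : Prop :=
  ∀ j < N, ∀ s ∈ Icc (t j) (t (j + 1)),
    f s = f (t j) + ((s - t j) / (t (j + 1) - t j)) • (f (t (j + 1)) - f (t j))

/-- `f` is constant on each mesh interval `[t_j, t_{j+1})`, `j < N`. -/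
def IsPiecewiseConstant (N : ℕ) (t : ℕ → ℝ) (f : ℝ → E) : Prop :=
  ∀ j < N, ∀ s ∈ Ico (t j) (t (j + 1)), f s = f (t j)

end Sobolev

section Sweeping

variable {n m d : ℕ}

/-- The normal cone of convex analysis, empty at points outside of the set. -/
def normalCone (C : Set (RSpace n)) (x : RSpace n) : Set (RSpace n) :=
  {v | x ∈ C ∧ ∀ y ∈ C, inner ℝ v (y - x) ≤ 0}

/-- The polyhedron `C(a,b) = {x : ⟨aᵢ, x⟩ ≤ bᵢ, i = 1, …, m}`. -/
def polyhedron (a : RFamily m n) (b : RSpace m) : Set (RSpace n) :=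
  {x | ∀ i, inner ℝ (a i) x ≤ b i}

/-- The sweeping velocity mapping `F(x,a,b,u) = N(x; C(a,b)) - g(x,u)`. -/
def velocityMap (g : RSpace n → RSpace d → RSpace n)
    (x : RSpace n) (a : RFamily m n) (b : RSpace m) (u : RSpace d) : Set (RSpace n) :=
  (fun v => v - g x u) '' normalCone (polyhedron a b) x

/-- Feasible quadruples of the controlled sweeping process on `[0,T]` with control set `U`,
perturbation `g` and initial data `x₀, a₀, b₀`. -/
structure IsFeasible (T : ℝ) (U : Set (RSpace d)) (g : RSpace n → RSpace d → RSpace n)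
    (x₀ : RSpace n) (a₀ : RFamily m n) (b₀ : RSpace m)
    (x : ℝ → RSpace n) (a : ℝ → RFamily m n) (b : ℝ → RSpace m) (u : ℝ → RSpace d) : Prop where
  a_mem : MemW12 T a
  b_mem : MemW12 T b
  u_mem : MemLp u 2 (timeMeasure T)
  x_init : x 0 = x₀
  a_init : a 0 = a₀
  b_init : b 0 = b₀
  /-- `x ∈ W^{1,2}` and `-ẋ(t) ∈ F(x(t), a(t), b(t), u(t))` for almost every `t ∈ [0,T]`. -/
  inclusion : ∃ w : ℝ → RSpace n, IsArcDeriv T x w ∧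
    ∀ᵐ t ∂(timeMeasure T), -w t ∈ velocityMap g (x t) (a t) (b t) (u t)
  u_constraint : ∀ᵐ t ∂(timeMeasure T), u t ∈ U
  a_norm : ∀ t ∈ Icc 0 T, ∀ i, ‖a t i‖ = 1
  state_constraint : ∀ t ∈ Icc 0 T, x t ∈ polyhedron (a t) (b t)

/-- The derivatives of `aᵢ` and `bᵢ` are essentially uniformly bounded on `[0,T]`. -/
def BoundedDerivs (T : ℝ) (a : ℝ → RFamily m n) (b : ℝ → RSpace m) : Prop :=
  ∃ (a' : ℝ → RFamily m n) (b' : ℝ → RSpace m) (R : ℝ), IsArcDeriv T a a' ∧ IsArcDeriv T b b' ∧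
    ∀ᵐ t ∂(timeMeasure T), ∀ i, ‖a' t i‖ ≤ R ∧ |b' t i| ≤ R

/-- `g` is Lipschitz continuous on `ℝⁿ × U` and of sublinear growth in `x`, uniformly in
`u ∈ U`. -/
def RegularPerturbation (U : Set (RSpace d)) (g : RSpace n → RSpace d → RSpace n) : Prop :=
  (∃ L > 0, ∀ x₁ x₂ : RSpace n, ∀ u₁ ∈ U, ∀ u₂ ∈ U,
    ‖g x₁ u₁ - g x₂ u₂‖ ≤ L * (‖x₁ - x₂‖ + ‖u₁ - u₂‖)) ∧
  (∃ M > 0, ∀ x : RSpace n, ∀ u ∈ U, ‖g x u‖ ≤ M * (1 + ‖x‖))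

/-- The increments of each `aᵢ` are dominated by those of a scalar `W^{1,2}` function. -/
def DominatedIncrements (T : ℝ) (a : ℝ → RFamily m n) : Prop :=
  ∃ v : Fin m → ℝ → ℝ, (∀ i, MemW12 T (v i)) ∧
    ∀ i, ∀ s ∈ Icc 0 T, ∀ t ∈ Icc 0 T, ‖a t i - a s i‖ ≤ |v i t - v i s|

/-- The uniform Slater condition: for some continuous `ϑ` on `[0,T]` with negative supremum, the
system `⟨aᵢ(t), y⟩ - bᵢ(t) < ϑ(t)`, `i = 1, …, m`, is solvable for every `t ∈ [0,T]`. -/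
def UniformSlater (T : ℝ) (a : ℝ → RFamily m n) (b : ℝ → RSpace m) : Prop :=
  ∃ ϑ : ℝ → ℝ, ContinuousOn ϑ (Icc 0 T) ∧ (∃ c < 0, ∀ t ∈ Icc 0 T, ϑ t ≤ c) ∧
    ∀ t ∈ Icc 0 T, ∃ y : RSpace n, ∀ i, inner ℝ (a t i) y - b t i < ϑ t

end Sweeping

end

/-!
Write the reference inclusion as `-ẋ(t) = p(t) - g(x(t), u(t))` with a normal vector `p(t)` of
`C(a(t), b(t))` at `x(t)`. Choose mesh points at which this inclusion holds, keep the normal vectors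
`p(t_j)` and run the explicit Euler method for `ż = g(z, u(t)) - p(t)`. Moving the offset `b_i(t_j)`
by `⟨a_i(t_j), y_j - x(t_j)⟩` translates the polyhedron by `y_j - x(t_j)`, so that `p(t_j)` is
normal to it at the discrete state `y_j`: the discrete inclusion holds exactly, with the original
`a_i(t_j)`.

The local error of the method is the difference between `ẋ(t_j)` and the mean of `ẋ` over the mesh
interval. A function of bounded variation is bounded and continuous almost everywhere, whence this
difference tends to zero boundedly almost everywhere, thus in `L¹`, and the discrete Gronwall
inequality gives `y_j - x(t_j) → 0` uniformly. All slopes then converge boundedly almost everywhere,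
which implies convergence in `L²`.
-/

noncomputable section

section BoundedConvergence

variable {E F G : Type*} [NormedAddCommGroup E] [NormedAddCommGroup F] [NormedAddCommGroup G]
  {T : ℝ} {V W : ℕ → ℝ → E} {v w : ℝ → E}

/-- Bounded convergence on `[0,T]`: almost everywhere, with an essential bound that does not depend
on the index. -/
structure TendstoBoundedly (T : ℝ) (V : ℕ → ℝ → E) (v : ℝ → E) : Prop where
  aestronglyMeasurable : ∀ k, AEStronglyMeasurable (V k) (timeMeasure T)
  bound : ∃ R, ∀ k, ∀ᵐ s ∂timeMeasure T, ‖V k s‖ ≤ R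
  tendsto : ∀ᵐ s ∂timeMeasure T, Tendsto (fun k => V k s) atTop (𝓝 (v s))

theorem TendstoL2.congr_ae (h : TendstoL2 T V v) (hvw : v =ᵐ[timeMeasure T] w) :
    TendstoL2 T V w :=
  ⟨h.1, h.2.1.ae_eq hvw, h.2.2.congr fun k => eLpNorm_congr_ae (hvw.mono fun s hs => by rw [hs])⟩

namespace TendstoBoundedly

theorem add (hV : TendstoBoundedly T V v) (hW : TendstoBoundedly T W w) :
    TendstoBoundedly T (fun k s => V k s + W k s) fun s => v s + w s := by
  obtain ⟨R, hR⟩ := hV.bound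
  obtain ⟨S, hS⟩ := hW.bound
  refine ⟨fun k => (hV.1 k).add (hW.1 k), ⟨R + S, fun k => ?_⟩, ?_⟩
  · filter_upwards [hR k, hS k] with s hr hs using norm_add_le_of_le hr hs
  · filter_upwards [hV.tendsto, hW.tendsto] with s hv hw using hv.add hw

theorem sub (hV : TendstoBoundedly T V v) (hW : TendstoBoundedly T W w) :
    TendstoBoundedly T (fun k s => V k s - W k s) fun s => v s - w s := by
  obtain ⟨R, hR⟩ := hV.bound
  obtain ⟨S, hS⟩ := hW.bound
  refine ⟨fun k => (hV.1 k).sub (hW.1 k), ⟨R + S, fun k => ?_⟩, ?_⟩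
  · filter_upwards [hR k, hS k] with s hr hs using norm_sub_le_of_le hr hs
  · filter_upwards [hV.tendsto, hW.tendsto] with s hv hw using hv.sub hw

theorem norm (hV : TendstoBoundedly T V v) :
    TendstoBoundedly T (fun k s => ‖V k s‖) fun s => ‖v s‖ :=
  ⟨fun k => (hV.1 k).norm, by simpa only [norm_norm] using hV.bound,
    hV.tendsto.mono fun _ hs => hs.norm⟩

theorem bilin [NormedSpace ℝ E] [NormedSpace ℝ F] [NormedSpace ℝ G] {W : ℕ → ℝ → F} {w : ℝ → F}
    (B : E →L[ℝ] F →L[ℝ] G) (hV : TendstoBoundedly T V v) (hW : TendstoBoundedly T W w) :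
    TendstoBoundedly T (fun k s => B (V k s) (W k s)) fun s => B (v s) (w s) := by
  obtain ⟨R, hR⟩ := hV.bound
  obtain ⟨S, hS⟩ := hW.bound
  refine ⟨fun k => B.aestronglyMeasurable_comp₂ (hV.1 k) (hW.1 k),
    ⟨‖B‖ * R * S, fun k => ?_⟩, ?_⟩
  · filter_upwards [hR k, hS k] with s hr hs
    calc ‖B (V k s) (W k s)‖ ≤ ‖B‖ * ‖V k s‖ * ‖W k s‖ := B.le_opNorm₂ _ _
      _ ≤ ‖B‖ * R * S :=
        mul_le_mul (mul_le_mul_of_nonneg_left hr (norm_nonneg B)) hs (norm_nonneg _)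
          (mul_nonneg (norm_nonneg B) ((norm_nonneg _).trans hr))
  · filter_upwards [hV.tendsto, hW.tendsto] with s hv hw
    exact (B.continuous₂.tendsto (v s, w s)).comp (hv.prodMk_nhds hw)

theorem ae_norm_le (hV : TendstoBoundedly T V v) : ∃ R, ∀ᵐ s ∂timeMeasure T, ‖v s‖ ≤ R := by
  obtain ⟨R, hR⟩ := hV.bound
  refine ⟨R, ?_⟩
  filter_upwards [hV.tendsto, ae_all_iff.2 hR] with s hs hRs
  exact le_of_tendsto hs.norm (Eventually.of_forall hRs)

theorem unifIntegrable (hV : TendstoBoundedly T V v) :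
    UnifIntegrable V 2 (timeMeasure T) := by
  obtain ⟨R, hR⟩ := hV.bound
  refine unifIntegrable_of one_le_two ENNReal.ofNat_ne_top hV.1
    fun ε _ => ⟨(R + 1).toNNReal, fun k => ?_⟩
  have hzero : {s | (R + 1).toNNReal ≤ ‖V k s‖₊}.indicator (V k) =ᵐ[timeMeasure T] 0 := by
    filter_upwards [hR k] with s hs
    refine indicator_of_notMem (fun hmem => ?_) _
    have hlarge : R + 1 ≤ ‖V k s‖ := Real.toNNReal_le_iff_le_coe.1 hmem
    linarith
  simp [eLpNorm_congr_ae hzero]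

theorem tendstoL2 (hV : TendstoBoundedly T V v) : TendstoL2 T V v := by
  obtain ⟨R, hR⟩ := hV.bound
  obtain ⟨S, hS⟩ := hV.ae_norm_le
  have hv : MemLp v 2 (timeMeasure T) :=
    MemLp.of_bound (aestronglyMeasurable_of_tendsto_ae _ hV.1 hV.tendsto) S hS
  exact ⟨fun k => MemLp.of_bound (hV.1 k) R (hR k), hv,
    tendsto_Lp_finite_of_tendsto_ae one_le_two ENNReal.ofNat_ne_top hV.1 hv hV.unifIntegrable
      hV.tendsto⟩

variable [NormedSpace ℝ E]

theorem tendsto_integral (hV : TendstoBoundedly T V v) {p : ℝ} (hp : p ∈ Icc 0 T) :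
    Tendsto (fun k => ∫ s in (0 : ℝ)..p, V k s) atTop (𝓝 (∫ s in (0 : ℝ)..p, v s)) := by
  obtain ⟨R, hR⟩ := hV.bound
  have hsub : uIoc 0 p ⊆ Icc 0 T := by
    rw [uIoc_of_le hp.1]
    exact fun s hs => ⟨hs.1.le, hs.2.trans hp.2⟩
  refine intervalIntegral.tendsto_integral_filter_of_dominated_convergence (fun _ => R)
    (Eventually.of_forall fun k => (hV.1 k).mono_set hsub)
    (Eventually.of_forall fun k => ?_) intervalIntegrable_const ?_
  · filter_upwards [ae_imp_of_ae_restrict (hR k)] with s hs hsp using hs (hsub hsp)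
  · filter_upwards [ae_imp_of_ae_restrict hV.tendsto] with s hs hsp using hs (hsub hsp)

end TendstoBoundedly

end BoundedConvergence

section Arcs

variable {E : Type*} [NormedAddCommGroup E] [NormedSpace ℝ E] {T : ℝ} {f v w : ℝ → E}

theorem isArcDeriv_primitive (hw : MemLp w 2 (timeMeasure T)) (y : E) :
    IsArcDeriv T (fun t => y + ∫ s in (0 : ℝ)..t, w s) w :=
  ⟨hw, fun t _ => by simp⟩

namespace IsArcDeriv

theorem congr_ae (h : IsArcDeriv T f v) (hvw : v =ᵐ[timeMeasure T] w) : IsArcDeriv T f w := by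
  refine ⟨h.1.ae_eq hvw, fun t ht => ?_⟩
  rw [h.2 t ht]
  congr 1
  refine intervalIntegral.integral_congr_ae ?_
  filter_upwards [ae_imp_of_ae_restrict hvw] with s hs hst
  rw [uIoc_of_le ht.1] at hst
  exact hs ⟨hst.1.le, hst.2.trans ht.2⟩

theorem integrableOn (h : IsArcDeriv T f w) : IntegrableOn w (Icc 0 T) :=
  h.1.integrable one_le_two

theorem intervalIntegrable (h : IsArcDeriv T f w) {p q : ℝ} (hp : p ∈ Icc 0 T)
    (hq : q ∈ Icc 0 T) : IntervalIntegrable w volume p q :=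
  (h.integrableOn.mono_set (ordConnected_Icc.uIcc_subset hp hq)).intervalIntegrable

theorem integral_eq (h : IsArcDeriv T f w) {p q : ℝ} (hp : p ∈ Icc 0 T) (hq : q ∈ Icc 0 T) :
    ∫ s in p..q, w s = f q - f p := by
  have h0 : (0 : ℝ) ∈ Icc 0 T := ⟨le_rfl, hp.1.trans hp.2⟩
  rw [h.2 p hp, h.2 q hq, add_sub_add_left_eq_sub, intervalIntegral.integral_interval_sub_left
    (h.intervalIntegrable h0 hq) (h.intervalIntegrable h0 hp)]

theorem norm_sub_le (h : IsArcDeriv T f w) {R : ℝ} (hR : ∀ᵐ s ∂timeMeasure T, ‖w s‖ ≤ R)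
    {p q : ℝ} (hp : p ∈ Icc 0 T) (hq : q ∈ Icc 0 T) : ‖f q - f p‖ ≤ R * |q - p| := by
  rw [← h.integral_eq hp hq]
  refine intervalIntegral.norm_integral_le_of_norm_le_const_ae ?_
  filter_upwards [ae_imp_of_ae_restrict hR] with s hs hspq
  exact hs (ordConnected_Icc.uIcc_subset hp hq (uIoc_subset_uIcc hspq))

theorem continuousOn (h : IsArcDeriv T f w) : ContinuousOn f (Icc 0 T) := by
  rcases lt_or_ge T 0 with hT | hT
  · simp [Icc_eq_empty hT.not_ge]
  have hprim : ContinuousOn (fun t => ∫ s in (0 : ℝ)..t, w s) (Icc 0 T) := by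
    rw [← uIcc_of_le hT]
    exact intervalIntegral.continuousOn_primitive_interval (by
      rw [uIcc_of_le hT]
      exact h.integrableOn)
  exact (hprim.const_add (f 0)).congr h.2

theorem ae_hasDerivAt [CompleteSpace E] (h : IsArcDeriv T f w) :
    ∀ᵐ t ∂timeMeasure T, HasDerivAt f (w t) t := by
  rw [timeMeasure, ← restrict_Ioo_eq_restrict_Icc, ae_restrict_iff' measurableSet_Ioo]
  rcases le_or_gt T 0 with hT | hT
  · simp [Ioo_eq_empty hT.not_gt]
  have h0 : (0 : ℝ) ∈ Icc 0 T := ⟨le_rfl, hT.le⟩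
  filter_upwards [(h.intervalIntegrable h0 ⟨hT.le, le_rfl⟩).ae_hasDerivAt_integral] with t ht htT
  rw [uIcc_of_le hT.le] at ht
  refine ((ht (Ioo_subset_Icc_self htT) 0 h0).const_add (f 0)).congr_of_eventuallyEq ?_
  filter_upwards [Ioo_mem_nhds htT.1 htT.2] with s hs using h.2 s (Ioo_subset_Icc_self hs)

theorem ae_eq [CompleteSpace E] (hv : IsArcDeriv T f v) (hw : IsArcDeriv T f w) :
    v =ᵐ[timeMeasure T] w := by
  filter_upwards [hv.ae_hasDerivAt, hw.ae_hasDerivAt] with t htv htw using htv.unique htw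

end IsArcDeriv

theorem TendstoBoundedly.tendstoW12 (hT : 0 ≤ T) {F V : ℕ → ℝ → E}
    (hF : ∀ k, IsArcDeriv T (F k) (V k)) (hF0 : ∀ k, F k 0 = f 0) (hf : IsArcDeriv T f v)
    (hV : TendstoBoundedly T V v) : TendstoW12 T F f := by
  obtain ⟨R, hR⟩ := hV.bound
  have hFf : TendstoBoundedly T F f := by
    refine ⟨fun k => (hF k).continuousOn.aestronglyMeasurable measurableSet_Icc,
      ⟨‖f 0‖ + |R| * T, fun k => ?_⟩, ?_⟩
    all_goals filter_upwards [ae_restrict_mem measurableSet_Icc] with t ht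
    · calc ‖F k t‖ ≤ ‖F k 0‖ + ‖F k t - F k 0‖ := norm_le_norm_add_norm_sub' _ _
        _ ≤ ‖F k 0‖ + |R| * |t - 0| := by
          gcongr
          exact (hF k).norm_sub_le ((hR k).mono fun s hs => hs.trans (le_abs_self R))
            ⟨le_rfl, hT⟩ ht
        _ ≤ ‖f 0‖ + |R| * T := by
          rw [hF0, sub_zero, abs_of_nonneg ht.1]
          gcongr
          exact ht.2
    · rw [hf.2 t ht]
      refine ((hV.tendsto_integral ht).const_add (f 0)).congr fun k => ?_
      rw [(hF k).2 t ht, hF0]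
  exact ⟨V, v, hF, hf, hFf.tendstoL2, hV.tendstoL2⟩

end Arcs

theorem update_ae_eq {X : Type*} (T : ℝ) (w : ℝ → X) (y : X) :
    Function.update w 0 y =ᵐ[timeMeasure T] w :=
  (ae_restrict_of_ae (Measure.ae_ne volume 0)).mono fun _ ht => Function.update_of_ne ht y w

section Riemann

variable {E : Type*} [NormedAddCommGroup E] {T : ℝ} {w : ℝ → E}

/-- Riemann integrability on `[0,T]`, in the form of Lebesgue's criterion: boundedness and
continuity at almost every point. -/
structure IsRiemann (T : ℝ) (w : ℝ → E) : Prop where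
  bound : ∃ R, ∀ t ∈ Icc 0 T, ‖w t‖ ≤ R
  ae_continuousWithinAt : ∀ᵐ t ∂timeMeasure T, ContinuousWithinAt w (Icc 0 T) t

theorem isRiemann_of_boundedVariationOn [NormedSpace ℝ E] [FiniteDimensional ℝ E]
    (hT : 0 ≤ T) (hw : BoundedVariationOn w (Icc 0 T)) : IsRiemann T w where
  bound := by
    refine ⟨‖w 0‖ + (eVariationOn w (Icc 0 T)).toReal, fun t ht => ?_⟩
    refine (norm_le_norm_add_norm_sub' (w t) (w 0)).trans ?_
    rw [← dist_eq_norm]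
    gcongr
    exact hw.dist_le ht ⟨le_rfl, hT⟩
  ae_continuousWithinAt :=
    (hw.locallyBoundedVariationOn.ae_differentiableWithinAt measurableSet_Icc).mono
      fun _ ht => ht.continuousWithinAt

theorem IsRiemann.update (hw : IsRiemann T w) (y : E) :
    IsRiemann T (Function.update w 0 y) := by
  obtain ⟨R, hR⟩ := hw.bound
  refine ⟨⟨max R ‖y‖, fun t ht => ?_⟩, ?_⟩
  · rcases eq_or_ne t 0 with rfl | h
    · simp
    · rw [Function.update_of_ne h]
      exact (hR t ht).trans (le_max_left _ _)
  · filter_upwards [hw.ae_continuousWithinAt, ae_restrict_of_ae (Measure.ae_ne volume 0)]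
      with t ht h0 using (continuousWithinAt_update_of_ne h0).2 ht

end Riemann

theorem tendsto_slope_straddle {E : Type*} [NormedAddCommGroup E] [NormedSpace ℝ E]
    {f : ℝ → E} {c : E} {s : ℝ} (hf : HasDerivAt f c s) {p q : ℕ → ℝ}
    (hps : ∀ k, p k ≤ s) (hsq : ∀ k, s ≤ q k) (hpq : ∀ k, p k < q k)
    (hp : Tendsto p atTop (𝓝 s)) (hq : Tendsto q atTop (𝓝 s)) :
    Tendsto (fun k => (q k - p k)⁻¹ • (f (q k) - f (p k))) atTop (𝓝 c) := by
  have hlittle := hasDerivAt_iff_isLittleO.1 hf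
  have hpo : (fun k => f (p k) - f s - (p k - s) • c) =o[atTop] fun k => q k - p k :=
    (hlittle.comp_tendsto hp).trans_isBigO <| Asymptotics.IsBigO.of_norm_le fun k => by
      simp only [Function.comp_apply, Real.norm_eq_abs]
      rw [abs_of_nonpos (by linarith [hps k])]
      linarith [hsq k]
  have hqo : (fun k => f (q k) - f s - (q k - s) • c) =o[atTop] fun k => q k - p k :=
    (hlittle.comp_tendsto hq).trans_isBigO <| Asymptotics.IsBigO.of_norm_le fun k => by
      simp only [Function.comp_apply, Real.norm_eq_abs]
      rw [abs_of_nonneg (by linarith [hsq k])]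
      linarith [hps k]
  have hlim := (hqo.sub hpo).tendsto_inv_smul_nhds_zero.add_const c
  rw [zero_add] at hlim
  refine hlim.congr fun k => ?_
  have hpos : q k - p k ≠ 0 := (sub_pos.2 (hpq k)).ne'
  rw [← inv_smul_smul₀ hpos c, ← smul_add, inv_smul_smul₀ hpos]
  congr 1
  module

section Mesh

variable {E : Type*} [NormedAddCommGroup E] {X : Type*} {T : ℝ} {N : ℕ} {t : ℕ → ℝ}

namespace IsPartition

theorem monotoneOn (h : IsPartition T N t) : MonotoneOn t (Iic N) :=
  (strictMonoOn_Iic_of_lt_succ h.lt).monotoneOn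

theorem mem_Icc (h : IsPartition T N t) {j : ℕ} (hj : j ≤ N) : t j ∈ Icc 0 T := by
  rw [← h.left, ← h.right]
  exact ⟨h.monotoneOn (Nat.zero_le N) hj (Nat.zero_le j), h.monotoneOn hj (mem_Iic.2 le_rfl) hj⟩

end IsPartition

/-- The index `j < N` of the mesh interval `[t_j, t_{j+1})` that contains `s`. -/
def meshIndex (N : ℕ) (t : ℕ → ℝ) (s : ℝ) : ℕ :=
  Nat.findGreatest (fun j => t j ≤ s) (N - 1)

theorem meshIndex_lt (hN : 0 < N) (s : ℝ) : meshIndex N t s < N :=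
  (Nat.findGreatest_le (N - 1)).trans_lt (Nat.sub_one_lt hN.ne')

theorem measurable_meshIndex : Measurable (meshIndex N t) :=
  measurable_findGreatest fun _ _ => measurableSet_Ici

theorem IsPartition.meshIndex_eq (h : IsPartition T N t) {j : ℕ} (hj : j < N) {s : ℝ}
    (hs : s ∈ Ico (t j) (t (j + 1))) : meshIndex N t s = j := by
  refine Nat.findGreatest_eq_iff.2 ⟨Nat.le_sub_one_of_lt hj, fun _ => hs.1, fun i hji hi hle => ?_⟩
  have hmono : t (j + 1) ≤ t i := h.monotoneOn hj (show i ≤ N by omega) hji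
  exact (hs.2.trans_le hmono).not_ge hle

theorem IsPartition.mem_meshIndex (h : IsPartition T N t) (hN : 0 < N) {s : ℝ}
    (hs : s ∈ Icc 0 T) : s ∈ Icc (t (meshIndex N t s)) (t (meshIndex N t s + 1)) := by
  refine ⟨Nat.findGreatest_spec (P := fun j => t j ≤ s) (Nat.zero_le _) (h.left ▸ hs.1), ?_⟩
  rcases (show meshIndex N t s + 1 ≤ N from meshIndex_lt hN s).lt_or_eq with hlt | heq
  · exact (not_le.1 (Nat.findGreatest_is_greatest (P := fun j => t j ≤ s) (Nat.lt_succ_self _)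
      (Nat.le_sub_one_of_lt hlt))).le
  · rw [heq, h.right]
    exact hs.2

/-- The step function with the values `c j` on the mesh intervals `[t_j, t_{j+1})`. Its value at
the end point `t_N` is `c (N - 1)`. -/
def stepFun (N : ℕ) (t : ℕ → ℝ) (c : ℕ → X) (s : ℝ) : X :=
  c (meshIndex N t s)

theorem stepFun_congr (hN : 0 < N) {c c' : ℕ → X} (hc : ∀ j < N, c j = c' j) :
    stepFun N t c = stepFun N t c' :=
  funext fun s => hc _ (meshIndex_lt hN s)

theorem stronglyMeasurable_stepFun (c : ℕ → E) : StronglyMeasurable (stepFun N t c) :=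
  (StronglyMeasurable.of_discrete (f := c)).comp_measurable measurable_meshIndex

theorem exists_norm_stepFun_le (c : ℕ → E) : ∃ R, ∀ s, ‖stepFun N t c s‖ ≤ R :=
  ⟨∑ j ∈ Finset.range (N - 1 + 1), ‖c j‖, fun _ =>
    Finset.single_le_sum (f := fun j => ‖c j‖) (fun _ _ => norm_nonneg _)
      (Finset.mem_range.2 (Nat.lt_succ_of_le (Nat.findGreatest_le (N - 1))))⟩

theorem memLp_stepFun (c : ℕ → E) : MemLp (stepFun N t c) 2 (timeMeasure T) := by
  obtain ⟨R, hR⟩ := exists_norm_stepFun_le (N := N) (t := t) c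
  exact MemLp.of_bound (stronglyMeasurable_stepFun c).aestronglyMeasurable R
    (Eventually.of_forall hR)

theorem intervalIntegrable_stepFun (c : ℕ → E) (p q : ℝ) :
    IntervalIntegrable (stepFun N t c) volume p q := by
  obtain ⟨R, hR⟩ := exists_norm_stepFun_le (N := N) (t := t) c
  exact (intervalIntegrable_const (c := R)).mono_fun
    (stronglyMeasurable_stepFun c).aestronglyMeasurable
    (Eventually.of_forall fun s => (hR s).trans (le_abs_self R))

namespace IsPartition

theorem stepFun_eq (h : IsPartition T N t) (c : ℕ → X) {j : ℕ} (hj : j < N) {s : ℝ}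
    (hs : s ∈ Ico (t j) (t (j + 1))) : stepFun N t c s = c j := by
  rw [stepFun, h.meshIndex_eq hj hs]

theorem stepFun_mesh (h : IsPartition T N t) (c : ℕ → X) {j : ℕ} (hj : j < N) :
    stepFun N t c (t j) = c j :=
  h.stepFun_eq c hj ⟨le_rfl, h.lt j hj⟩

theorem isPiecewiseConstant_stepFun (h : IsPartition T N t) (c : ℕ → X) :
    IsPiecewiseConstant N t (stepFun N t c) :=
  fun j hj s hs => by rw [h.stepFun_eq c hj hs, h.stepFun_mesh c hj]

variable [NormedSpace ℝ E] [CompleteSpace E]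

theorem integral_stepFun (h : IsPartition T N t) (c : ℕ → E) {j : ℕ} (hj : j < N) {s : ℝ}
    (hs : s ∈ Icc (t j) (t (j + 1))) :
    ∫ r in (t j)..s, stepFun N t c r = (s - t j) • c j := by
  rw [← intervalIntegral.integral_const]
  refine intervalIntegral.integral_congr_uIoo fun r hr => ?_
  rw [uIoo_of_le hs.1] at hr
  exact h.stepFun_eq c hj ⟨hr.1.le, hr.2.trans_le hs.2⟩

theorem integral_stepFun_mesh (h : IsPartition T N t) (c : ℕ → E) {j : ℕ} (hj : j ≤ N) :
    ∫ r in (0 : ℝ)..t j, stepFun N t c r = ∑ i ∈ Finset.range j, (t (i + 1) - t i) • c i := by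
  rw [← h.left, ← intervalIntegral.sum_integral_adjacent_intervals
    fun i _ => intervalIntegrable_stepFun c _ _]
  refine Finset.sum_congr rfl fun i hi => ?_
  have hiN : i < N := (Finset.mem_range.1 hi).trans_le hj
  exact h.integral_stepFun c hiN ⟨(h.lt i hiN).le, le_rfl⟩

end IsPartition

variable [NormedSpace ℝ E]

/-- The difference quotients of the nodal values `y` over the mesh intervals. -/
def meshSlope (t : ℕ → ℝ) (y : ℕ → E) (j : ℕ) : E :=
  (t (j + 1) - t j)⁻¹ • (y (j + 1) - y j)

theorem meshSlope_sub (t : ℕ → ℝ) (y z : ℕ → E) (j : ℕ) :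
    meshSlope t (fun i => y i - z i) j = meshSlope t y j - meshSlope t z j := by
  rw [meshSlope, meshSlope, meshSlope, ← smul_sub, sub_sub_sub_comm]

theorem meshSlope_add_bilin {F G : Type*} [NormedAddCommGroup F] [NormedSpace ℝ F]
    [NormedAddCommGroup G] [NormedSpace ℝ G] (B : E →L[ℝ] F →L[ℝ] G) (t : ℕ → ℝ) (z : ℕ → G)
    (α : ℕ → E) (e : ℕ → F) (j : ℕ) :
    meshSlope t (fun i => z i + B (α i) (e i)) j =
      meshSlope t z j + B (α (j + 1)) (meshSlope t e j) + B (meshSlope t α j) (e j) := by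
  simp only [meshSlope, map_smul, map_sub, smul_apply, sub_apply]
  module

theorem IsPartition.smul_meshSlope (h : IsPartition T N t) (y : ℕ → E) {j : ℕ} (hj : j < N) :
    (t (j + 1) - t j) • meshSlope t y j = y (j + 1) - y j :=
  smul_inv_smul₀ (sub_pos.2 (h.lt j hj)).ne' _

theorem IsPartition.norm_meshSlope_le (h : IsPartition T N t) {f w : ℝ → E}
    (hf : IsArcDeriv T f w) {R : ℝ} (hR : ∀ᵐ s ∂timeMeasure T, ‖w s‖ ≤ R) {j : ℕ} (hj : j < N) :
    ‖meshSlope t (fun i => f (t i)) j‖ ≤ R := by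
  have hpos := sub_pos.2 (h.lt j hj)
  rw [meshSlope, norm_smul, Real.norm_of_nonneg (inv_nonneg.2 hpos.le), inv_mul_le_iff₀ hpos,
    mul_comm, ← abs_of_pos hpos]
  exact hf.norm_sub_le hR (h.mem_Icc hj.le) (h.mem_Icc hj)

/-- The continuous piecewise linear function on `[0,T]` with the value `y j` at `t_j`, defined as
the integral of its slopes. -/
def polygon (N : ℕ) (t : ℕ → ℝ) (y : ℕ → E) (s : ℝ) : E :=
  y 0 + ∫ r in (0 : ℝ)..s, stepFun N t (meshSlope t y) r

theorem polygon_zero (y : ℕ → E) : polygon N t y 0 = y 0 := by simp [polygon]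

theorem isArcDeriv_polygon (y : ℕ → E) :
    IsArcDeriv T (polygon N t y) (stepFun N t (meshSlope t y)) :=
  isArcDeriv_primitive (memLp_stepFun _) (y 0)

namespace IsPartition

variable [CompleteSpace E]

theorem polygon_mesh (h : IsPartition T N t) (y : ℕ → E) {j : ℕ} (hj : j ≤ N) :
    polygon N t y (t j) = y j := by
  have hsum : ∑ i ∈ Finset.range j, (t (i + 1) - t i) • meshSlope t y i = y j - y 0 := by
    rw [← Finset.sum_range_sub]
    exact Finset.sum_congr rfl fun i hi =>
      h.smul_meshSlope y ((Finset.mem_range.1 hi).trans_le hj)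
  rw [polygon, h.integral_stepFun_mesh _ hj, hsum, add_sub_cancel]

theorem polygon_eq (h : IsPartition T N t) (y : ℕ → E) {j : ℕ} (hj : j < N) {s : ℝ}
    (hs : s ∈ Icc (t j) (t (j + 1))) :
    polygon N t y s = polygon N t y (t j) + (s - t j) • meshSlope t y j := by
  have hsplit := intervalIntegral.integral_add_adjacent_intervals
    (intervalIntegrable_stepFun (N := N) (t := t) (meshSlope t y) 0 (t j))
    (intervalIntegrable_stepFun _ (t j) s)
  rw [polygon, polygon, ← hsplit, h.integral_stepFun _ hj hs, add_assoc]

theorem isPiecewiseLinear_polygon (h : IsPartition T N t) (y : ℕ → E) :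
    IsPiecewiseLinear N t (polygon N t y) := by
  intro j hj s hs
  rw [h.polygon_eq y hj hs, h.polygon_mesh y hj.le, h.polygon_mesh y hj, ← h.smul_meshSlope y hj,
    smul_smul, div_mul_cancel₀ _ (sub_pos.2 (h.lt j hj)).ne']

end IsPartition

end Mesh

theorem exists_mem_Ioo_of_ae {T p q : ℝ} {G : Set ℝ} (hG : ∀ᵐ s ∂timeMeasure T, s ∈ G)
    (hp : 0 ≤ p) (hpq : p < q) (hq : q ≤ T) : ∃ s ∈ Ioo p q, s ∈ G := by
  obtain ⟨s, hs, hps, hsq⟩ := (Measure.dense_of_ae (ae_imp_of_ae_restrict hG)).exists_between hpq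
  exact ⟨s, ⟨hps, hsq⟩, hs ⟨hp.trans hps.le, hsq.le.trans hq⟩⟩

theorem exists_isPartition_of_ae {T : ℝ} (hT : 0 < T) {G : Set ℝ}
    (hG : ∀ᵐ s ∂timeMeasure T, s ∈ G) (h0 : (0 : ℝ) ∈ G) {N : ℕ} (hN : 0 < N) :
    ∃ τ : ℕ → ℝ, IsPartition T N τ ∧ (∀ j < N, τ j ∈ G) ∧
      ∀ j < N, τ (j + 1) - τ j ≤ 2 * T / N := by
  obtain ⟨h, hpos, rfl⟩ : ∃ h, 0 < h ∧ N * h = T :=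
    ⟨T / N, by positivity, mul_div_cancel₀ T (by positivity)⟩
  -- Points in the first halves of the uniform mesh intervals have gaps in `[h/2, 3h/2]`.
  have hpoint : ∀ j ≤ N, ∃ s ∈ Icc (j * h) (j * h + h / 2),
      (j = 0 → s = 0) ∧ (j = N → s = N * h) ∧ (j < N → s ∈ G) := by
    intro j hj
    rcases j.eq_zero_or_pos with rfl | hj0
    · exact ⟨0, by simp [(half_pos hpos).le], by simp [h0, hN.ne]⟩
    rcases hj.eq_or_lt with rfl | hjN
    · exact ⟨j * h, by simp [(half_pos hpos).le], by simp [hj0.ne']⟩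
    have hle : ((j : ℝ) + 1) * h ≤ N * h := by gcongr; exact_mod_cast hjN
    obtain ⟨s, hs, hsG⟩ := exists_mem_Ioo_of_ae hG (p := j * h) (q := j * h + h / 2)
      (by positivity) (by linarith) (by linarith)
    exact ⟨s, Ioo_subset_Icc_self hs, fun h => absurd h hj0.ne', fun h => absurd h hjN.ne,
      fun _ => hsG⟩
  choose! τ hτ hτ0 hτN hτG using hpoint
  have hsucc : ∀ j < N, τ (j + 1) ∈ Icc ((j + 1) * h) ((j + 1) * h + h / 2) :=
    fun j hj => by exact_mod_cast hτ (j + 1) hj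
  refine ⟨τ, ⟨hτ0 0 hN.le rfl, hτN N le_rfl rfl, fun j hj => ?_⟩,
    fun j hj => hτG j hj.le hj, fun j hj => ?_⟩
  · linarith [(hτ j hj.le).2, (hsucc j hj).1]
  · have hsize : 2 * (N * h) / N = 2 * h := by field_simp
    linarith [(hτ j hj.le).1, (hsucc j hj).2]

section MeshSequences

variable {E : Type*} [NormedAddCommGroup E] {T : ℝ} {N : ℕ → ℕ} {t : ℕ → ℕ → ℝ} {μ : ℕ → ℝ}
  {f v w : ℝ → E}

/-- A sequence of partitions `t k` of `[0,T]` into `N k` intervals of length at most `μ k`, where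
`μ k` tends to zero. -/
structure IsMeshSeq (T : ℝ) (N : ℕ → ℕ) (t : ℕ → ℕ → ℝ) (μ : ℕ → ℝ) : Prop where
  pos : ∀ k, 0 < N k
  part : ∀ k, IsPartition T (N k) (t k)
  size : ∀ k, ∀ j < N k, t k (j + 1) - t k j ≤ μ k
  lim : Tendsto μ atTop (𝓝 0)

theorem exists_isMeshSeq_of_ae (hT : 0 < T) {G : Set ℝ} (hG : ∀ᵐ s ∂timeMeasure T, s ∈ G)
    (h0 : (0 : ℝ) ∈ G) :
    ∃ τ, IsMeshSeq T (fun k => k + 1) τ (fun k => 2 * T / (k + 1 : ℕ)) ∧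
      ∀ k, ∀ j < k + 1, τ k j ∈ G := by
  choose τ hτ hτG hτsize using fun k : ℕ => exists_isPartition_of_ae hT hG h0 k.succ_pos
  exact ⟨τ, ⟨fun k => k.succ_pos, hτ, hτsize,
    (tendsto_const_div_atTop_nhds_zero_nat (2 * T)).comp (tendsto_add_atTop_nat 1)⟩, hτG⟩

theorem tendstoBoundedly_stepFun (hN : ∀ k, 0 < N k) {c : ℕ → ℕ → E} {R : ℝ}
    (hR : ∀ k, ∀ j < N k, ‖c k j‖ ≤ R)
    (hlim : ∀ᵐ s ∂timeMeasure T,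
      Tendsto (fun k => stepFun (N k) (t k) (c k) s) atTop (𝓝 (v s))) :
    TendstoBoundedly T (fun k => stepFun (N k) (t k) (c k)) v :=
  ⟨fun _ => (stronglyMeasurable_stepFun _).aestronglyMeasurable,
    ⟨R, fun k => Eventually.of_forall fun s => hR k _ (meshIndex_lt (hN k) s)⟩, hlim⟩

theorem tendstoBoundedly_stepFun_zero (hN : ∀ k, 0 < N k) {c : ℕ → ℕ → E} {η : ℕ → ℝ}
    (hη : Tendsto η atTop (𝓝 0)) (hc : ∀ k, ∀ j < N k, ‖c k j‖ ≤ η k) :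
    TendstoBoundedly T (fun k => stepFun (N k) (t k) (c k)) fun _ => 0 := by
  obtain ⟨R, hR⟩ := hη.bddAbove_range
  exact tendstoBoundedly_stepFun hN (fun k j hj => (hc k j hj).trans (hR (mem_range_self k)))
    (Eventually.of_forall fun s => squeeze_zero_norm (fun k => hc k _ (meshIndex_lt (hN k) s)) hη)

namespace IsMeshSeq

theorem tendsto_of_mem (h : IsMeshSeq T N t μ) {s : ℝ} (hs : s ∈ Icc 0 T) {r : ℕ → ℝ}
    (hr : ∀ k, r k ∈ Icc (t k (meshIndex (N k) (t k) s)) (t k (meshIndex (N k) (t k) s + 1))) :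
    Tendsto r atTop (𝓝[Icc 0 T] s) := by
  have hlt : ∀ k, meshIndex (N k) (t k) s < N k := fun k => meshIndex_lt (h.pos k) s
  refine tendsto_nhdsWithin_iff.2 ⟨?_, Eventually.of_forall fun k => ?_⟩
  · refine tendsto_iff_dist_tendsto_zero.2 (squeeze_zero (fun _ => dist_nonneg) (fun k => ?_) h.lim)
    exact (Real.dist_le_of_mem_Icc (hr k) ((h.part k).mem_meshIndex (h.pos k) hs)).trans
      (h.size k _ (hlt k))
  · exact Icc_subset_Icc ((h.part k).mem_Icc (hlt k).le).1 ((h.part k).mem_Icc (hlt k)).2 (hr k)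

theorem tendsto_left (h : IsMeshSeq T N t μ) {s : ℝ} (hs : s ∈ Icc 0 T) :
    Tendsto (fun k => t k (meshIndex (N k) (t k) s)) atTop (𝓝[Icc 0 T] s) :=
  h.tendsto_of_mem hs fun k => ⟨le_rfl, ((h.part k).lt _ (meshIndex_lt (h.pos k) s)).le⟩

theorem tendsto_right (h : IsMeshSeq T N t μ) {s : ℝ} (hs : s ∈ Icc 0 T) :
    Tendsto (fun k => t k (meshIndex (N k) (t k) s + 1)) atTop (𝓝[Icc 0 T] s) :=
  h.tendsto_of_mem hs fun k => ⟨((h.part k).lt _ (meshIndex_lt (h.pos k) s)).le, le_rfl⟩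

theorem tendstoBoundedly_left (h : IsMeshSeq T N t μ) (hw : IsRiemann T w) :
    TendstoBoundedly T (fun k => stepFun (N k) (t k) fun j => w (t k j)) w := by
  obtain ⟨R, hR⟩ := hw.bound
  refine tendstoBoundedly_stepFun h.pos (fun k j hj => hR _ ((h.part k).mem_Icc hj.le)) ?_
  filter_upwards [hw.ae_continuousWithinAt, ae_restrict_mem measurableSet_Icc] with s hws hs
    using hws.tendsto.comp (h.tendsto_left hs)

theorem tendstoBoundedly_right (h : IsMeshSeq T N t μ) (hw : ContinuousOn w (Icc 0 T)) :
    TendstoBoundedly T (fun k => stepFun (N k) (t k) fun j => w (t k (j + 1))) w := by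
  obtain ⟨R, hR⟩ := isCompact_Icc.exists_bound_of_continuousOn hw
  refine tendstoBoundedly_stepFun h.pos (fun k j hj => hR _ ((h.part k).mem_Icc hj)) ?_
  filter_upwards [ae_restrict_mem measurableSet_Icc] with s hs
    using (hw s hs).tendsto.comp (h.tendsto_right hs)

variable [NormedSpace ℝ E]

theorem tendstoBoundedly_meshSlope [CompleteSpace E] (h : IsMeshSeq T N t μ)
    (hf : IsArcDeriv T f w) {R : ℝ} (hR : ∀ᵐ s ∂timeMeasure T, ‖w s‖ ≤ R) :
    TendstoBoundedly T (fun k => stepFun (N k) (t k) (meshSlope (t k) fun j => f (t k j))) w := by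
  refine tendstoBoundedly_stepFun h.pos (fun k j hj => (h.part k).norm_meshSlope_le hf hR hj) ?_
  filter_upwards [hf.ae_hasDerivAt, ae_restrict_mem measurableSet_Icc] with s hfs hs
  have hmem := fun k => (h.part k).mem_meshIndex (h.pos k) hs
  exact tendsto_slope_straddle hfs (fun k => (hmem k).1) (fun k => (hmem k).2)
    (fun k => (h.part k).lt _ (meshIndex_lt (h.pos k) s))
    (tendsto_nhds_of_tendsto_nhdsWithin (h.tendsto_left hs))
    (tendsto_nhds_of_tendsto_nhdsWithin (h.tendsto_right hs))

end IsMeshSeq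

theorem tendstoW12_polygon [NormedSpace ℝ E] (hT : 0 ≤ T) {y : ℕ → ℕ → E}
    (hy : ∀ k, y k 0 = f 0) (hf : IsArcDeriv T f w)
    (hslope : TendstoBoundedly T (fun k => stepFun (N k) (t k) (meshSlope (t k) (y k))) w) :
    TendstoW12 T (fun k => polygon (N k) (t k) (y k)) f :=
  hslope.tendstoW12 hT (fun k => isArcDeriv_polygon (y k))
    (fun k => (polygon_zero (y k)).trans (hy k)) hf

theorem IsMeshSeq.tendstoW12_interpolant [NormedSpace ℝ E] [CompleteSpace E]
    (h : IsMeshSeq T N t μ) (hT : 0 ≤ T) (hf : IsArcDeriv T f w) {R : ℝ}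
    (hR : ∀ᵐ s ∂timeMeasure T, ‖w s‖ ≤ R) :
    TendstoW12 T (fun k => polygon (N k) (t k) fun j => f (t k j)) f :=
  tendstoW12_polygon hT (fun k => by rw [(h.part k).left]) hf (h.tendstoBoundedly_meshSlope hf hR)

end MeshSequences

theorem discrete_gronwall_of_lt {u b c : ℕ → ℝ} {N : ℕ} (hu0 : 0 ≤ u 0)
    (hu : ∀ n < N, u (n + 1) ≤ (1 + c n) * u n + b n) (hb : ∀ n < N, 0 ≤ b n)
    (hc : ∀ n < N, 0 ≤ c n) {n : ℕ} (hn : n ≤ N) :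
    u n ≤ (u 0 + ∑ i ∈ Finset.range n, b i) * Real.exp (∑ i ∈ Finset.range n, c i) := by
  have hgronwall := discrete_gronwall (n₀ := 0) (u := fun n => u (min n N))
    (b := fun n => if n < N then b n else 0) (c := fun n => if n < N then c n else 0)
    (by simpa using hu0) (fun n _ => ?_) (fun n _ => ?_) (fun n _ => ?_) n.zero_le
  · rw [min_eq_left hn, Nat.zero_min, ← Finset.range_eq_Ico] at hgronwall
    have hlt : ∀ i ∈ Finset.range n, i < N := fun i hi => (Finset.mem_range.1 hi).trans_le hn
    rwa [Finset.sum_congr rfl fun i hi => if_pos (hlt i hi),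
      Finset.sum_congr rfl fun i hi => if_pos (hlt i hi)] at hgronwall
  · rcases lt_or_ge n N with h | h
    · simpa [h, h.le, Nat.succ_le_of_lt h] using hu n h
    · simp [h.not_gt, h, h.trans n.le_succ]
  · split_ifs with h
    exacts [hc n h, le_rfl]
  · split_ifs with h
    exacts [hb n h, le_rfl]

section Euler

variable {E : Type*} [NormedAddCommGroup E] [NormedSpace ℝ E]

/-- The nodal values `y_{j+1} = y_j + (t_{j+1} - t_j) φ(t_j, y_j)` of the explicit Euler method. -/
def eulerNodes (φ : ℝ → E → E) (t : ℕ → ℝ) (y₀ : E) : ℕ → E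
  | 0 => y₀
  | j + 1 => eulerNodes φ t y₀ j + (t (j + 1) - t j) • φ (t j) (eulerNodes φ t y₀ j)

variable {T : ℝ} {φ : ℝ → E → E} {K : NNReal} {x w : ℝ → E}

namespace IsPartition

variable {N : ℕ} {t : ℕ → ℝ}

theorem meshSlope_eulerNodes (h : IsPartition T N t) (y₀ : E) {j : ℕ} (hj : j < N) :
    meshSlope t (eulerNodes φ t y₀) j = φ (t j) (eulerNodes φ t y₀ j) := by
  rw [meshSlope, eulerNodes, add_sub_cancel_left, inv_smul_smul₀ (sub_pos.2 (h.lt j hj)).ne']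

theorem norm_eulerNodes_succ_sub_le (h : IsPartition T N t) (y₀ : E) (z : ℕ → E) {j : ℕ}
    (hj : j < N) (hφ : LipschitzWith K (φ (t j))) :
    ‖eulerNodes φ t y₀ (j + 1) - z (j + 1)‖ ≤
      (1 + K * (t (j + 1) - t j)) * ‖eulerNodes φ t y₀ j - z j‖ +
        (t (j + 1) - t j) * ‖φ (t j) (z j) - meshSlope t z j‖ := by
  have hpos := sub_pos.2 (h.lt j hj)
  set y := eulerNodes φ t y₀ with hy
  have hstep : y (j + 1) - z (j + 1) = (y j - z j) +
      ((t (j + 1) - t j) • (φ (t j) (y j) - φ (t j) (z j)) +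
        (t (j + 1) - t j) • (φ (t j) (z j) - meshSlope t z j)) := by
    rw [smul_sub _ _ (meshSlope t z j), h.smul_meshSlope z hj, hy, eulerNodes]
    module
  calc ‖y (j + 1) - z (j + 1)‖
      ≤ ‖y j - z j‖ + ((t (j + 1) - t j) * ‖φ (t j) (y j) - φ (t j) (z j)‖ +
        (t (j + 1) - t j) * ‖φ (t j) (z j) - meshSlope t z j‖) := by
        rw [hstep, ← norm_smul_of_nonneg hpos.le, ← norm_smul_of_nonneg hpos.le]
        exact norm_add_le_of_le le_rfl (norm_add_le _ _)
    _ ≤ ‖y j - z j‖ + ((t (j + 1) - t j) * (K * ‖y j - z j‖) +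
        (t (j + 1) - t j) * ‖φ (t j) (z j) - meshSlope t z j‖) := by
        gcongr
        exact hφ.norm_sub_le _ _
    _ = _ := by ring

theorem norm_eulerNodes_sub_le (h : IsPartition T N t) (hφ : ∀ j < N, LipschitzWith K (φ (t j)))
    (z : ℕ → E) {j : ℕ} (hj : j ≤ N) :
    ‖eulerNodes φ t (z 0) j - z j‖ ≤
      (∫ s in (0 : ℝ)..t j, ‖stepFun N t (fun i => φ (t i) (z i) - meshSlope t z i) s‖) *
        Real.exp (K * t j) := by
  have hgap : ∀ i < N, 0 ≤ t (i + 1) - t i := fun i hi => (sub_pos.2 (h.lt i hi)).le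
  have hintegral := h.integral_stepFun_mesh (fun i => ‖φ (t i) (z i) - meshSlope t z i‖) hj
  have hlength : ∑ i ∈ Finset.range j, K * (t (i + 1) - t i) = K * t j := by
    rw [← Finset.mul_sum, Finset.sum_range_sub, h.left, sub_zero]
  have hgronwall := discrete_gronwall_of_lt (u := fun i => ‖eulerNodes φ t (z 0) i - z i‖)
    (norm_nonneg _) (fun i hi => h.norm_eulerNodes_succ_sub_le (z 0) z hi (hφ i hi))
    (fun i hi => mul_nonneg (hgap i hi) (norm_nonneg _))
    (fun i hi => mul_nonneg K.2 (hgap i hi)) hj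
  simp only [smul_eq_mul] at hintegral
  rw [hlength, ← hintegral, eulerNodes, sub_self, norm_zero, zero_add] at hgronwall
  exact hgronwall

end IsPartition

namespace IsMeshSeq

variable [CompleteSpace E] {N : ℕ → ℕ} {t : ℕ → ℕ → ℝ} {μ : ℕ → ℝ}

theorem exists_norm_eulerNodes_sub_le (h : IsMeshSeq T N t μ) (hT : 0 ≤ T)
    (hx : IsArcDeriv T x w) (hw : IsRiemann T w)
    (hφ : ∀ k, ∀ j < N k, LipschitzWith K (φ (t k j)))
    (hφx : ∀ k, ∀ j < N k, φ (t k j) (x (t k j)) = w (t k j)) :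
    ∃ η : ℕ → ℝ, Tendsto η atTop (𝓝 0) ∧
      ∀ k, ∀ j ≤ N k, ‖eulerNodes φ (t k) (x 0) j - x (t k j)‖ ≤ η k := by
  obtain ⟨R, hR⟩ := hw.bound
  have hresidual := ((h.tendstoBoundedly_left hw).sub (h.tendstoBoundedly_meshSlope hx
    ((ae_restrict_mem measurableSet_Icc).mono hR))).norm.tendsto_integral ⟨hT, le_rfl⟩
  simp only [sub_self, norm_zero, intervalIntegral.integral_zero] at hresidual
  refine ⟨_, by simpa using hresidual.mul_const (Real.exp (K * T)), fun k j hj => ?_⟩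
  have hbound := (h.part k).norm_eulerNodes_sub_le (hφ k) (fun i => x (t k i)) hj
  rw [(h.part k).left, stepFun_congr (h.pos k) fun i hi => by rw [hφx k i hi]] at hbound
  have hmem := (h.part k).mem_Icc hj
  refine hbound.trans (mul_le_mul ?_ (by gcongr; exact hmem.2) (Real.exp_pos _).le ?_)
  · exact intervalIntegral.integral_mono_interval le_rfl hmem.1 hmem.2
      (Eventually.of_forall fun _ => norm_nonneg _) (intervalIntegrable_stepFun _ _ _).norm
  · exact intervalIntegral.integral_nonneg hT fun _ _ => norm_nonneg _

theorem tendstoBoundedly_meshSlope_eulerNodes (h : IsMeshSeq T N t μ) (hT : 0 ≤ T)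
    (hx : IsArcDeriv T x w) (hw : IsRiemann T w)
    (hφ : ∀ k, ∀ j < N k, LipschitzWith K (φ (t k j)))
    (hφx : ∀ k, ∀ j < N k, φ (t k j) (x (t k j)) = w (t k j)) :
    TendstoBoundedly T
      (fun k => stepFun (N k) (t k) (meshSlope (t k) (eulerNodes φ (t k) (x 0)))) w := by
  obtain ⟨η, hη, hηx⟩ := h.exists_norm_eulerNodes_sub_le hT hx hw hφ hφx
  have hdefect : ∀ k, ∀ j < N k,
      ‖φ (t k j) (eulerNodes φ (t k) (x 0) j) - w (t k j)‖ ≤ K * η k := by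
    intro k j hj
    rw [← hφx k j hj]
    exact ((hφ k j hj).norm_sub_le _ _).trans (by gcongr; exact hηx k j hj.le)
  have hlim := (tendstoBoundedly_stepFun_zero (t := t) (T := T) h.pos
    (by simpa using hη.const_mul (K : ℝ)) hdefect).add
    (h.tendstoBoundedly_left hw)
  simp only [zero_add] at hlim
  convert hlim using 2 with k
  rw [stepFun_congr (h.pos k) fun j hj => (h.part k).meshSlope_eulerNodes (x 0) hj]
  exact funext fun s => (sub_add_cancel _ _).symm

end IsMeshSeq

end Euler

theorem IsMeshSeq.tendstoBoundedly_meshSlope_add_bilin {E F G : Type*} [NormedAddCommGroup E]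
    [NormedSpace ℝ E] [CompleteSpace E] [NormedAddCommGroup F] [NormedSpace ℝ F]
    [NormedAddCommGroup G] [NormedSpace ℝ G] [CompleteSpace G] {T : ℝ} {N : ℕ → ℕ}
    {t : ℕ → ℕ → ℝ} {μ : ℕ → ℝ} (h : IsMeshSeq T N t μ) (B : E →L[ℝ] F →L[ℝ] G)
    {a a' : ℝ → E} {b b' : ℝ → G} {R : ℝ} (ha : IsArcDeriv T a a')
    (haR : ∀ᵐ s ∂timeMeasure T, ‖a' s‖ ≤ R) (hb : IsArcDeriv T b b')
    (hbR : ∀ᵐ s ∂timeMeasure T, ‖b' s‖ ≤ R) {e : ℕ → ℕ → F} {η : ℕ → ℝ}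
    (hη : Tendsto η atTop (𝓝 0)) (heη : ∀ k, ∀ j ≤ N k, ‖e k j‖ ≤ η k)
    (he : TendstoBoundedly T (fun k => stepFun (N k) (t k) (meshSlope (t k) (e k))) fun _ => 0) :
    TendstoBoundedly T (fun k => stepFun (N k) (t k)
      (meshSlope (t k) fun j => b (t k j) + B (a (t k j)) (e k j))) b' := by
  have he0 := tendstoBoundedly_stepFun_zero (t := t) (T := T) h.pos hη
    fun k j hj => heη k j hj.le
  have hsum := ((h.tendstoBoundedly_meshSlope hb hbR).add
    ((h.tendstoBoundedly_right ha.continuousOn).bilin B he)).add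
      ((h.tendstoBoundedly_meshSlope ha haR).bilin B he0)
  simp only [map_zero, add_zero] at hsum
  convert hsum using 2 with k
  exact funext fun s => meshSlope_add_bilin B _ _ _ _ _

section Sweeping

variable {n m d : ℕ} {T : ℝ} {U : Set (RSpace d)} {g : RSpace n → RSpace d → RSpace n}
  {x₀ : RSpace n} {a₀ : RFamily m n} {b₀ : RSpace m}
  {x w : ℝ → RSpace n} {a : ℝ → RFamily m n} {b : ℝ → RSpace m} {u ω : ℝ → RSpace d}

theorem norm_piLp_two_le {ι : Type*} [Fintype ι] {β : ι → Type*}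
    [∀ i, SeminormedAddCommGroup (β i)] {z : PiLp 2 β} {R : ℝ} (hz : ∀ i, ‖z i‖ ≤ R) :
    ‖z‖ ≤ √(Fintype.card ι) * |R| := by
  rw [PiLp.norm_eq_of_L2, ← Real.sqrt_sq_eq_abs, ← Real.sqrt_mul (Nat.cast_nonneg _),
    ← nsmul_eq_mul]
  refine Real.sqrt_le_sqrt (Finset.sum_le_card_nsmul _ _ _ fun i _ => ?_)
  gcongr
  exact hz i

theorem BoundedDerivs.exists_norm_le (h : BoundedDerivs T a b) :
    ∃ (a' : ℝ → RFamily m n) (b' : ℝ → RSpace m) (R : ℝ), IsArcDeriv T a a' ∧ IsArcDeriv T b b' ∧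
      (∀ᵐ s ∂timeMeasure T, ‖a' s‖ ≤ R) ∧ ∀ᵐ s ∂timeMeasure T, ‖b' s‖ ≤ R := by
  obtain ⟨a', b', R, ha, hb, hR⟩ := h
  exact ⟨a', b', _, ha, hb, hR.mono fun s hs => norm_piLp_two_le fun i => (hs i).1,
    hR.mono fun s hs => norm_piLp_two_le fun i => (hs i).2⟩

theorem RegularPerturbation.exists_lipschitzWith (h : RegularPerturbation U g) :
    ∃ K : NNReal, ∀ v ∈ U, LipschitzWith K fun z => g z v := by
  obtain ⟨⟨L, -, hg⟩, -⟩ := h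
  exact ⟨L.toNNReal, fun v hv => LipschitzWith.of_dist_le' fun y z => by
    simpa [dist_eq_norm] using hg y z v hv v hv⟩

/-- The bilinear map `(a, x) ↦ (⟨a₁, x⟩, …, ⟨a_m, x⟩)`, by which `x` is paired with the normals of
a polyhedron. -/
def rowPairing : RFamily m n →L[ℝ] RSpace n →L[ℝ] RSpace m :=
  (LinearMap.mk₂ ℝ (fun (a : RFamily m n) (x : RSpace n) =>
      (WithLp.toLp 2 fun i => inner ℝ (a i) x : RSpace m))
    (fun a a' x => by ext i; simp [inner_add_left])
    (fun c a x => by ext i; simp [inner_smul_left])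
    (fun a x x' => by ext i; simp [inner_add_right])
    (fun c a x => by ext i; simp [inner_smul_right])).mkContinuous₂ 1 fun a x => by
      refine le_of_sq_le_sq ?_ (by positivity)
      rw [one_mul, mul_pow, EuclideanSpace.norm_sq_eq, PiLp.norm_sq_eq_of_L2, Finset.sum_mul]
      refine Finset.sum_le_sum fun i _ => ?_
      rw [← mul_pow]
      exact pow_le_pow_left₀ (norm_nonneg _) (norm_inner_le_norm _ _) 2

theorem rowPairing_apply (a : RFamily m n) (x : RSpace n) (i : Fin m) :
    rowPairing a x i = inner ℝ (a i) x := rfl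

theorem add_mem_polyhedron_iff {a : RFamily m n} {b : RSpace m} {z p : RSpace n} :
    z + p ∈ polyhedron a (b + rowPairing a p) ↔ z ∈ polyhedron a b :=
  forall_congr' fun i => by simp [rowPairing_apply, inner_add_right]

theorem normalCone_polyhedron_add (a : RFamily m n) (b : RSpace m) (z p : RSpace n) :
    normalCone (polyhedron a (b + rowPairing a p)) (z + p) = normalCone (polyhedron a b) z := by
  ext v
  refine and_congr add_mem_polyhedron_iff ((Equiv.addRight p).surjective.forall.trans ?_)
  simp only [Equiv.coe_addRight, add_mem_polyhedron_iff, add_sub_add_right_eq_sub]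

theorem neg_perturbation_mem_velocityMap {z : RSpace n} {a : RFamily m n} {b : RSpace m}
    {v : RSpace d} (hz : z ∈ polyhedron a b) : -g z v ∈ velocityMap g z a b v :=
  ⟨0, ⟨hz, by simp⟩, zero_sub _⟩

/-- The times at which the velocity `w` and the control `ω` satisfy the sweeping inclusion and the
control constraint. -/
def sweepingTimes (U : Set (RSpace d)) (g : RSpace n → RSpace d → RSpace n) (x : ℝ → RSpace n)
    (a : ℝ → RFamily m n) (b : ℝ → RSpace m) (w : ℝ → RSpace n) (ω : ℝ → RSpace d) : Set ℝ :=
  {t | -w t ∈ velocityMap g (x t) (a t) (b t) (ω t) ∧ ω t ∈ U}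

theorem IsFeasible.nonempty_controlSet (h : IsFeasible T U g x₀ a₀ b₀ x a b u) (hT : 0 < T) :
    U.Nonempty := by
  obtain ⟨t, -, ht⟩ := exists_mem_Ioo_of_ae h.u_constraint le_rfl hT le_rfl
  exact ⟨u t, ht⟩

theorem IsFeasible.ae_mem_sweepingTimes (h : IsFeasible T U g x₀ a₀ b₀ x a b u)
    (hx : IsArcDeriv T x w) (hu : ω =ᵐ[timeMeasure T] u) :
    ∀ᵐ t ∂timeMeasure T, t ∈ sweepingTimes U g x a b w ω := by
  obtain ⟨w', hw', hincl⟩ := h.inclusion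
  filter_upwards [hincl, h.u_constraint, hu, hx.ae_eq hw'] with t hinclt hut hωt hwt
  simpa only [sweepingTimes, mem_ofPred_eq, hωt, hwt] using And.intro hinclt hut

theorem IsFeasible.exists_reference (h : IsFeasible T U g x₀ a₀ b₀ x a b u) (hT : 0 < T)
    (hx : ∃ w, IsArcDeriv T x w ∧ IsRiemann T w)
    (hu : ∃ ω, u =ᵐ[timeMeasure T] ω ∧ IsRiemann T ω) :
    ∃ w ω, IsArcDeriv T x w ∧ IsRiemann T w ∧ ω =ᵐ[timeMeasure T] u ∧ IsRiemann T ω ∧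
      0 ∈ sweepingTimes U g x a b w ω ∧ ∀ᵐ t ∂timeMeasure T, t ∈ sweepingTimes U g x a b w ω := by
  obtain ⟨w, hw, hwR⟩ := hx
  obtain ⟨ω, hω, hωR⟩ := hu
  obtain ⟨u₀, hu₀⟩ := h.nonempty_controlSet hT
  have hw' := hw.congr_ae (update_ae_eq T w (g (x 0) u₀)).symm
  have hω' := (update_ae_eq T ω u₀).trans hω.symm
  refine ⟨_, _, hw', hwR.update _, hω', hωR.update _, ?_, h.ae_mem_sweepingTimes hw' hω'⟩
  simp only [sweepingTimes, mem_ofPred_eq, Function.update_self]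
  exact ⟨neg_perturbation_mem_velocityMap (h.state_constraint 0 ⟨le_rfl, hT.le⟩), hu₀⟩

/-- The velocity field along the reference process `(x, w, ω)` in which the normal vector
`g(x(s), ω(s)) - w(s)` of the reference velocity `w` is kept at every state `z`. -/
def referenceField (g : RSpace n → RSpace d → RSpace n) (x w : ℝ → RSpace n)
    (ω : ℝ → RSpace d) (s : ℝ) (z : RSpace n) : RSpace n :=
  g z (ω s) - g (x s) (ω s) + w s

theorem referenceField_self (s : ℝ) : referenceField g x w ω s (x s) = w s := by
  rw [referenceField, sub_self, zero_add]

theorem lipschitzWith_referenceField {K : NNReal} {s : ℝ}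
    (hg : LipschitzWith K fun z => g z (ω s)) : LipschitzWith K (referenceField g x w ω s) :=
  LipschitzWith.of_dist_le_mul fun y z => by
    simpa only [referenceField, dist_add_right, dist_sub_right] using hg.dist_le_mul y z

theorem neg_referenceField_mem_velocityMap {s : ℝ}
    (h : -w s ∈ velocityMap g (x s) (a s) (b s) (ω s)) (z : RSpace n) :
    -referenceField g x w ω s z ∈
      velocityMap g z (a s) (b s + rowPairing (a s) (z - x s)) (ω s) := by
  obtain ⟨p, hp, hpw : p - g (x s) (ω s) = -w s⟩ := h
  rw [sub_eq_iff_eq_add] at hpw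
  refine ⟨p, ?_, ?_⟩
  · simpa only [add_sub_cancel] using (normalCone_polyhedron_add (a s) (b s) (x s) (z - x s)).ge hp
  · simp only [referenceField, hpw]
    abel

/-- The nodal states of the discrete sweeping process: the Euler method for the reference field. -/
def discreteState (g : RSpace n → RSpace d → RSpace n) (x w : ℝ → RSpace n) (ω : ℝ → RSpace d)
    (t : ℕ → ℝ) : ℕ → RSpace n :=
  eulerNodes (referenceField g x w ω) t (x 0)

/-- The nodal offsets of the discrete sweeping process, for which the polyhedron at `t_j` is
translated by the error of the discrete state. -/
def discreteOffset (g : RSpace n → RSpace d → RSpace n) (x w : ℝ → RSpace n) (a : ℝ → RFamily m n)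
    (b : ℝ → RSpace m) (ω : ℝ → RSpace d) (t : ℕ → ℝ) (j : ℕ) : RSpace m :=
  b (t j) + rowPairing (a (t j)) (discreteState g x w ω t j - x (t j))

theorem discreteOffset_zero {t : ℕ → ℝ} (ht : t 0 = 0) :
    discreteOffset g x w a b ω t 0 = b 0 := by
  rw [discreteOffset, discreteState, eulerNodes, ht, sub_self, map_zero, add_zero]

theorem IsPartition.neg_meshSlope_discreteState_mem {N : ℕ} {t : ℕ → ℝ} (h : IsPartition T N t)
    {j : ℕ} (hj : j < N)
    (hw : -w (t j) ∈ velocityMap g (x (t j)) (a (t j)) (b (t j)) (ω (t j))) :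
    -meshSlope t (discreteState g x w ω t) j ∈ velocityMap g (discreteState g x w ω t j) (a (t j))
      (discreteOffset g x w a b ω t j) (ω (t j)) := by
  rw [discreteState, h.meshSlope_eulerNodes _ hj]
  exact neg_referenceField_mem_velocityMap hw _

namespace IsMeshSeq

variable {N : ℕ → ℕ} {t : ℕ → ℕ → ℝ} {μ : ℕ → ℝ} {K : NNReal}

theorem tendstoW12_discreteState (h : IsMeshSeq T N t μ) (hT : 0 ≤ T) (hx : IsArcDeriv T x w)
    (hw : IsRiemann T w) (hg : ∀ k, ∀ j < N k, LipschitzWith K fun z => g z (ω (t k j))) :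
    TendstoW12 T (fun k => polygon (N k) (t k) (discreteState g x w ω (t k))) x :=
  tendstoW12_polygon hT (fun _ => rfl) hx (h.tendstoBoundedly_meshSlope_eulerNodes hT hx hw
    (fun k j hj => lipschitzWith_referenceField (hg k j hj)) fun _ _ _ => referenceField_self _)

theorem tendstoW12_discreteOffset (h : IsMeshSeq T N t μ) (hT : 0 ≤ T) (hx : IsArcDeriv T x w)
    (hw : IsRiemann T w) (hg : ∀ k, ∀ j < N k, LipschitzWith K fun z => g z (ω (t k j)))
    {a' : ℝ → RFamily m n} {b' : ℝ → RSpace m} {R : ℝ} (ha : IsArcDeriv T a a')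
    (haR : ∀ᵐ s ∂timeMeasure T, ‖a' s‖ ≤ R) (hb : IsArcDeriv T b b')
    (hbR : ∀ᵐ s ∂timeMeasure T, ‖b' s‖ ≤ R) :
    TendstoW12 T (fun k => polygon (N k) (t k) (discreteOffset g x w a b ω (t k))) b := by
  have hφ : ∀ k, ∀ j < N k, LipschitzWith K (referenceField g x w ω (t k j)) :=
    fun k j hj => lipschitzWith_referenceField (hg k j hj)
  have hφx : ∀ k, ∀ j < N k, referenceField g x w ω (t k j) (x (t k j)) = w (t k j) :=
    fun _ _ _ => referenceField_self _
  obtain ⟨S, hS⟩ := hw.bound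
  obtain ⟨η, hη, hηx⟩ := h.exists_norm_eulerNodes_sub_le hT hx hw hφ hφx
  have herror := (h.tendstoBoundedly_meshSlope_eulerNodes hT hx hw hφ hφx).sub
    (h.tendstoBoundedly_meshSlope hx ((ae_restrict_mem measurableSet_Icc).mono hS))
  simp only [sub_self] at herror
  refine tendstoW12_polygon hT (fun k => discreteOffset_zero (h.part k).left) hb
    (h.tendstoBoundedly_meshSlope_add_bilin rowPairing ha haR hb hbR hη hηx ?_)
  convert herror using 2 with k
  exact funext fun s => meshSlope_sub _ _ _ _

end IsMeshSeq

theorem theorem4p1_general {K : NNReal} (hT : 0 < T)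
    (hfeas : IsFeasible T U g x₀ a₀ b₀ x a b u) (hab : BoundedDerivs T a b)
    (hg : ∀ v ∈ U, LipschitzWith K fun z => g z v)
    (hx : ∃ w, IsArcDeriv T x w ∧ IsRiemann T w)
    (hu : ∃ w, u =ᵐ[timeMeasure T] w ∧ IsRiemann T w) :
    ∃ (νt : ℝ) (ν : ℕ → ℕ) (τ : ℕ → ℕ → ℝ) (δ : ℕ → ℝ)
      (xk : ℕ → ℝ → RSpace n) (ak : ℕ → ℝ → RFamily m n) (bk : ℕ → ℝ → RSpace m)
      (uk : ℕ → ℝ → RSpace d),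
      0 < νt ∧
      (∀ k, k ≤ ν k ∧ IsPartition T (ν k) (τ k) ∧
        ∀ j < ν k, τ k (j + 1) - τ k j ≤ νt / (ν k : ℝ)) ∧
      (∀ k, 0 < δ k) ∧ Tendsto δ atTop (𝓝 0) ∧
      (∀ k, IsPiecewiseLinear (ν k) (τ k) (xk k) ∧ IsPiecewiseLinear (ν k) (τ k) (ak k) ∧
        IsPiecewiseLinear (ν k) (τ k) (bk k) ∧ IsPiecewiseConstant (ν k) (τ k) (uk k)) ∧
      (∀ k, xk k 0 = x₀ ∧ ak k 0 = a₀ ∧ bk k 0 = b₀) ∧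
      (∀ k, ∀ t ∈ Icc 0 T, uk k t ∈ U) ∧
      (∀ k, ∀ j ≤ ν k, ∀ i, 1 - δ k ≤ ‖ak k (τ k j) i‖ ∧ ‖ak k (τ k j) i‖ ≤ 1 + δ k) ∧
      (∀ k, ∀ j < ν k, ∃ v : RSpace n,
        -v ∈ velocityMap g (xk k (τ k j)) (ak k (τ k j)) (bk k (τ k j)) (uk k (τ k j)) ∧
        ∀ t ∈ Icc (τ k j) (τ k (j + 1)), xk k t = xk k (τ k j) + (t - τ k j) • v) ∧
      TendstoW12 T xk x ∧ TendstoW12 T ak a ∧ TendstoW12 T bk b ∧ TendstoL2 T uk u := by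
  obtain ⟨w, ω, hw, hwR, hωu, hωR, h0, hae⟩ := hfeas.exists_reference hT hx hu
  obtain ⟨a', b', R, ha, hb, haR, hbR⟩ := hab.exists_norm_le
  obtain ⟨τ, hmesh, hτ⟩ := exists_isMeshSeq_of_ae hT hae h0
  have hpart := hmesh.part
  have hgτ : ∀ k, ∀ j < k + 1, LipschitzWith K fun z => g z (ω (τ k j)) :=
    fun k j hj => hg _ (hτ k j hj).2
  refine ⟨2 * T, fun k => k + 1, τ, fun k => 1 / ((k : ℝ) + 1),
    fun k => polygon (k + 1) (τ k) (discreteState g x w ω (τ k)),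
    fun k => polygon (k + 1) (τ k) fun j => a (τ k j),
    fun k => polygon (k + 1) (τ k) (discreteOffset g x w a b ω (τ k)),
    fun k => stepFun (k + 1) (τ k) fun j => ω (τ k j),
    by positivity, fun k => ⟨k.le_succ, hpart k, hmesh.size k⟩, fun k => by positivity,
    tendsto_one_div_add_atTop_nhds_zero_nat,
    fun k => ⟨(hpart k).isPiecewiseLinear_polygon _, (hpart k).isPiecewiseLinear_polygon _,
      (hpart k).isPiecewiseLinear_polygon _, (hpart k).isPiecewiseConstant_stepFun _⟩,
    fun k => ⟨?_, ?_, ?_⟩, fun k s _ => (hτ k _ (meshIndex_lt k.succ_pos s)).2,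
    fun k j hj i => ?_, fun k j hj => ⟨meshSlope (τ k) (discreteState g x w ω (τ k)) j, ?_,
      fun s hs => (hpart k).polygon_eq _ hj hs⟩,
    hmesh.tendstoW12_discreteState hT.le hw hwR hgτ, hmesh.tendstoW12_interpolant hT.le ha haR,
    hmesh.tendstoW12_discreteOffset hT.le hw hwR hgτ ha haR hb hbR,
    (hmesh.tendstoBoundedly_left hωR).tendstoL2.congr_ae hωu⟩
  · exact (polygon_zero _).trans hfeas.x_init
  · exact (polygon_zero _).trans (by rw [(hpart k).left, hfeas.a_init])
  · exact (polygon_zero _).trans ((discreteOffset_zero (hpart k).left).trans hfeas.b_init)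
  · have hδ : (0 : ℝ) ≤ 1 / ((k : ℝ) + 1) := by positivity
    simp only [(hpart k).polygon_mesh _ hj, hfeas.a_norm _ ((hpart k).mem_Icc hj) i]
    exact ⟨sub_le_self _ hδ, le_add_of_nonneg_right hδ⟩
  · simp only [(hpart k).polygon_mesh _ hj.le, (hpart k).stepFun_mesh _ hj]
    exact (hpart k).neg_meshSlope_discreteState_mem hj (hτ k j hj).1

end Sweeping

end

theorem theorem4p1 {n m d : ℕ} (T : ℝ) (hT : 0 < T)
    (U : Set (RSpace d)) (g : RSpace n → RSpace d → RSpace n)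
    (x₀ : RSpace n) (a₀ : RFamily m n) (b₀ : RSpace m)
    (x : ℝ → RSpace n) (a : ℝ → RFamily m n) (b : ℝ → RSpace m) (u : ℝ → RSpace d)
    (hfeas : IsFeasible T U g x₀ a₀ b₀ x a b u)
    -- the standing assumptions
    (hU : IsClosed U ∧ Bornology.IsBounded U)
    (hab : BoundedDerivs T a b)
    (hg : RegularPerturbation U g)
    (hdom : DominatedIncrements T a)
    (hslater : UniformSlater T a b)
    -- bounded variation of the derivatives and of the control
    (hx_bv : HasBVDeriv T x) (ha_bv : HasBVDeriv T a) (hb_bv : HasBVDeriv T b)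
    (hu_bv : ∃ w : ℝ → RSpace d, (∀ᵐ t ∂(timeMeasure T), u t = w t) ∧
      BoundedVariationOn w (Icc 0 T)) :
    ∃ (νt : ℝ) (ν : ℕ → ℕ) (τ : ℕ → ℕ → ℝ) (δ : ℕ → ℝ)
      (xk : ℕ → ℝ → RSpace n) (ak : ℕ → ℝ → RFamily m n) (bk : ℕ → ℝ → RSpace m)
      (uk : ℕ → ℝ → RSpace d),
      -- the partitions
      0 < νt ∧
      (∀ k, k ≤ ν k ∧ IsPartition T (ν k) (τ k) ∧
        ∀ j < ν k, τ k (j + 1) - τ k j ≤ νt / (ν k : ℝ)) ∧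
      -- the tolerances
      (∀ k, 0 < δ k) ∧ Tendsto δ atTop (𝓝 0) ∧
      -- the shape of the approximations and their initial data
      (∀ k, IsPiecewiseLinear (ν k) (τ k) (xk k) ∧ IsPiecewiseLinear (ν k) (τ k) (ak k) ∧
        IsPiecewiseLinear (ν k) (τ k) (bk k) ∧ IsPiecewiseConstant (ν k) (τ k) (uk k)) ∧
      (∀ k, xk k 0 = x₀ ∧ ak k 0 = a₀ ∧ bk k 0 = b₀) ∧
      (∀ k, ∀ t ∈ Icc 0 T, uk k t ∈ U) ∧
      -- the relaxed norm constraints at the mesh points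
      (∀ k, ∀ j ≤ ν k, ∀ i, 1 - δ k ≤ ‖ak k (τ k j) i‖ ∧ ‖ak k (τ k j) i‖ ≤ 1 + δ k) ∧
      -- the discrete sweeping inclusion
      (∀ k, ∀ j < ν k, ∃ v : RSpace n,
        -v ∈ velocityMap g (xk k (τ k j)) (ak k (τ k j)) (bk k (τ k j)) (uk k (τ k j)) ∧
        ∀ t ∈ Icc (τ k j) (τ k (j + 1)), xk k t = xk k (τ k j) + (t - τ k j) • v) ∧
      -- strong convergence
      TendstoW12 T xk x ∧ TendstoW12 T ak a ∧ TendstoW12 T bk b ∧ TendstoL2 T uk u := by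
  obtain ⟨K, hK⟩ := hg.exists_lipschitzWith
  exact theorem4p1_general hT hfeas hab hK
    (hx_bv.imp fun _ h => ⟨h.1, isRiemann_of_boundedVariationOn hT.le h.2⟩)
    (hu_bv.imp fun _ h => ⟨h.1, isRiemann_of_boundedVariationOn hT.le h.2⟩)
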